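/- **Setting.** Let $k$ be a commutative ring containing an element $i$ with $i^2=-1$, let $A\in k$ be invertible (for instance $k=\mathbb{C}[A,A^{-1}]$), and put $\delta=-A^2-A^{-2}$. Let $$M=\begin{pmatrix}0 & iA\\ -iA^{-1} & 0\end{pmatrix},\qquad M_{ab}=M^{ab}\ \text{ the entries of } M,\qquad \eta=MM^{t},$$ $$U^{ab}_{cd}=M^{ab}M_{cd},\qquad R^{ab}_{cd}=A\,M^{ab}M_{cd}+A^{-1}\delta^a_c\delta^b_d ,\qquad (R^{-1})^{ab}_{cd}=A^{-1}M^{ab}M_{cd}+A\,\delta^a_c\delta^b_d .$$ Let $n\ge 1$ and $V=k^2$. The Temperley–Lieb algebra $TL_n$ over $k$ is generated by $U_1,\dots,U_{n-1}$ with relations $U_i^2=\delta U_i$, $U_iU_{i\pm1}U_i=U_i$, and $U_iU_j=U_jU_i$ for $|i-j|>1$. It acts on $V^{\otimes n}$: $U_i$ acts by the matrix $U$ on the tensor factors $i,i+1$ and by the identity on the others. Let $B_n$ be the Artin braid group with generators $\sigma_1,\dots,\sigma_{n-1}$, and let $\rho:B_n\to TL_n$ be the representation with $\rho(\sigma_i)=AU_i+A^{-1}$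 and $\rho(\sigma_i^{-1})=A^{-1}U_i+A$. Elements of $TL_n$ are identified with their matrices on $V^{\otimes n}$ inside traces. For an unoriented link diagram $K$ with at least one component, the bracket is $\langle K\rangle=\sum_S\langle K|S\rangle\,\delta^{\|S\|-1}$. The sum is over all states $S$ (a choice of $A$- or $B$-smoothing at every crossing), $\langle K|S\rangle$ is the product of the vertex weights ($A$ for an $A$-smoothing, $A^{-1}$ for a $B$-smoothing), and $\|S\|$ is the number of loops of $S$. The crossing of $\sigma_i$ is the one whose $A$-smoothing is the cup over the cap, that is, the diagram of $U_i$. If $K$ is arranged with respect to the vertical direction, its amplitude $Z(K)$ is the sum, over all assignments of indices in $\{1,2\}$ to its vertical arcs, of the product of a factor $M_{ab}$ for each maximum, $M^{ab}$ for each minimum, and an entry of $R$ or $R^{-1}$ for each crossing of type $\sigma_i$ or $\sigma_i^{-1}$, respectively. Upper indices of $R^{\pm1}$ are read at the top of the crossing and lower indices at its bottom. **Theorem.** 1. For every product $Q=U_{i_1}U_{i_2}\cdots U_{i_m}$ ($m\ge0$) in $TL_n$, $$\mathrm{Trace}(\eta^{\otimes n}Q)=\delta^{\lambda(Q)},$$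 where $\lambda(Q)$ is the number of loops in the braid closure of the diagram obtained by stacking the diagrams of $U_{i_1},\dots,U_{i_m}$ (closed loops inside the stacked diagram included). 2. Let $b\in B_n$, let $w$ be any word in the $\sigma_i^{\pm1}$ that represents $b$, and let $K$ be the closure of the braid diagram of $w$, in which for each strand position $s$ one maximum and one minimum join the top and the bottom of the braid at $s$ to a returning strand on the right. Then $$Z(K)=\delta\langle K\rangle=\mathrm{Trace}\bigl(\eta^{\otimes n}\rho(b)\bigr).$$ -/

import Mathlib

namespace BraidTrace

/-! ### Braid groups -/

/-- The relators of the Artin presentation; `σ_1, …, σ_{n-1}` are indexed by `Fin (n - 1)`. -/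
inductive BraidRelator (n : ℕ) : FreeGroup (Fin (n - 1)) → Prop
  | braid (i j : Fin (n - 1)) (h : (i : ℕ) + 1 = j) :
      BraidRelator n (FreeGroup.of i * FreeGroup.of j * FreeGroup.of i *
        (FreeGroup.of j * FreeGroup.of i * FreeGroup.of j)⁻¹)
  | comm (i j : Fin (n - 1)) (h : (i : ℕ) + 1 < j) :
      BraidRelator n (FreeGroup.of i * FreeGroup.of j * (FreeGroup.of j * FreeGroup.of i)⁻¹)

/-- The Artin braid group on `n` strands. -/
abbrev BraidGroup (n : ℕ) : Type := PresentedGroup {r | BraidRelator n r}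

/-- The braid generator that twists strands `i` and `i + 1`. -/
def sigma {n : ℕ} (i : Fin (n - 1)) : BraidGroup n := PresentedGroup.of i

/-- A braid word: `(i, true)` stands for `σ_i` and `(i, false)` for `σ_i⁻¹`. Words are read from
the top of the braid to its bottom. -/
abbrev BraidWord (n : ℕ) : Type := List (Fin (n - 1) × Bool)

/-- The braid that a braid word represents. -/
def BraidWord.toBraid {n : ℕ} (w : BraidWord n) : BraidGroup n :=
  PresentedGroup.mk _ (FreeGroup.mk w)

/-- The left one of the two strands on which the `i`-th generator acts. -/
def left {n : ℕ} (i : Fin (n - 1)) : Fin n := ⟨i, by omega⟩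

/-- The right one of the two strands on which the `i`-th generator acts. -/
def right {n : ℕ} (i : Fin (n - 1)) : Fin n := ⟨i + 1, by omega⟩

theorem left_ne_right {n : ℕ} (i : Fin (n - 1)) : left i ≠ right i := by
  simp [left, right, Fin.ext_iff]

/-! ### Temperley–Lieb algebras -/

/-- The defining relations of the Temperley–Lieb algebra. -/
inductive TLRel (k : Type*) [CommRing k] (d : k) (n : ℕ) :
    FreeAlgebra k (Fin (n - 1)) → FreeAlgebra k (Fin (n - 1)) → Prop
  | sq (i : Fin (n - 1)) :
      TLRel k d n (FreeAlgebra.ι k i * FreeAlgebra.ι k i) (d • FreeAlgebra.ι k i)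
  | adj (i j : Fin (n - 1)) (h : (i : ℕ) + 1 = j ∨ (j : ℕ) + 1 = i) :
      TLRel k d n (FreeAlgebra.ι k i * FreeAlgebra.ι k j * FreeAlgebra.ι k i) (FreeAlgebra.ι k i)
  | comm (i j : Fin (n - 1)) (h : (i : ℕ) + 1 < j) :
      TLRel k d n (FreeAlgebra.ι k i * FreeAlgebra.ι k j) (FreeAlgebra.ι k j * FreeAlgebra.ι k i)

/-- The Temperley–Lieb algebra `TL_n` over `k` with loop value `d`. -/
abbrev TemperleyLieb (k : Type*) [CommRing k] (d : k) (n : ℕ) : Type _ := RingQuot (TLRel k d n)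

/-- The generator `U_i` of `TL_n`. -/
def genU (k : Type*) [CommRing k] (d : k) {n : ℕ} (i : Fin (n - 1)) : TemperleyLieb k d n :=
  RingQuot.mkAlgHom k (TLRel k d n) (FreeAlgebra.ι k i)

section
variable {k : Type*} [CommRing k] {d : k} {n : ℕ}

theorem genU_sq (i : Fin (n - 1)) : genU k d i * genU k d i = d • genU k d i := by
  simpa [genU] using RingQuot.mkAlgHom_rel k (TLRel.sq (k := k) (d := d) i)

theorem genU_adj (i j : Fin (n - 1)) (h : (i : ℕ) + 1 = j ∨ (j : ℕ) + 1 = i) :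
    genU k d i * genU k d j * genU k d i = genU k d i := by
  simpa [genU] using RingQuot.mkAlgHom_rel k (TLRel.adj (k := k) (d := d) i j h)

theorem genU_comm (i j : Fin (n - 1)) (h : (i : ℕ) + 1 < j) :
    genU k d i * genU k d j = genU k d j * genU k d i := by
  simpa [genU] using RingQuot.mkAlgHom_rel k (TLRel.comm (k := k) (d := d) i j h)

end

/-- The loop value `δ = -A² - A⁻²`. -/
def loopValue {k : Type*} [CommRing k] (A : kˣ) : k := -(A : k) ^ 2 - ((A⁻¹ : kˣ) : k) ^ 2

/-! ### The representation of the braid group in the Temperley–Lieb algebra -/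
section
variable {k R : Type*} [CommRing k] [Ring R] [Algebra k R]

theorem aux_inv {a b d : k} (hab : a * b = 1) (hd : d = -a ^ 2 - b ^ 2) {U : R}
    (hU : U * U = d • U) : (a • U + b • (1 : R)) * (b • U + a • (1 : R)) = 1 := by
  simp only [add_mul, mul_add, smul_mul_assoc, mul_smul_comm, smul_smul, hU, mul_one, one_mul, hd]
  linear_combination (norm := module) (-(a ^ 2 + b ^ 2)) • congrArg (· • U) hab +
    congrArg (· • (1 : R)) hab

theorem aux_comm (a b : k) {U V : R} (h : U * V = V * U) :
    (a • U + b • (1 : R)) * (a • V + b • (1 : R)) =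
      (a • V + b • (1 : R)) * (a • U + b • (1 : R)) := by
  simp only [add_mul, mul_add, smul_mul_assoc, mul_smul_comm, mul_one, one_mul, h]
  module

theorem aux_braid {a b d : k} (hab : a * b = 1) (hd : d = -a ^ 2 - b ^ 2) {U V : R}
    (hU : U * U = d • U) (hV : V * V = d • V) (hUV : U * V * U = U) (hVU : V * U * V = V) :
    (a • U + b • (1 : R)) * (a • V + b • (1 : R)) * (a • U + b • (1 : R)) =
      (a • V + b • (1 : R)) * (a • U + b • (1 : R)) * (a • V + b • (1 : R)) := by
  simp only [add_mul, mul_add, smul_mul_assoc, mul_smul_comm, smul_smul, mul_one, one_mul,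
    hU, hV, hUV, hVU, hd]
  linear_combination (norm := module) (-(a * b ^ 2 + a ^ 3)) • congrArg (· • (U - V)) hab
end

/-- `A U_i + A⁻¹` as a unit of `TL_n`, with inverse `A⁻¹ U_i + A`. -/
def braidGen {k : Type*} [CommRing k] (A : kˣ) {n : ℕ} (i : Fin (n - 1)) :
    (TemperleyLieb k (loopValue A) n)ˣ where
  val := (A : k) • genU k (loopValue A) i + ((A⁻¹ : kˣ) : k) • 1
  inv := ((A⁻¹ : kˣ) : k) • genU k (loopValue A) i + (A : k) • 1
  val_inv := aux_inv A.mul_inv rfl (genU_sq i)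
  inv_val := aux_inv A.inv_mul (by rw [loopValue]; ring) (genU_sq i)

theorem braidGen_relator {k : Type*} [CommRing k] (A : kˣ) {n : ℕ}
    (r : FreeGroup (Fin (n - 1))) (hr : r ∈ {r | BraidRelator n r}) :
    FreeGroup.lift (braidGen A) r = 1 := by
  rcases hr with ⟨i, j, h⟩ | ⟨i, j, h⟩
  · simp only [map_mul, map_inv, FreeGroup.lift_apply_of]
    rw [mul_inv_eq_one]
    ext
    exact aux_braid A.mul_inv rfl (genU_sq i) (genU_sq j) (genU_adj i j (.inl h))
      (genU_adj j i (.inr h))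
  · simp only [map_mul, map_inv, FreeGroup.lift_apply_of]
    rw [mul_inv_eq_one]
    ext
    exact aux_comm _ _ (genU_comm i j h)

/-- The representation `ρ : B_n → TL_n` with `ρ(σ_i) = A U_i + A⁻¹` and
`ρ(σ_i⁻¹) = A⁻¹ U_i + A`. -/
def rho {k : Type*} [CommRing k] (A : kˣ) (n : ℕ) :
    BraidGroup n →* TemperleyLieb k (loopValue A) n :=
  (Units.coeHom _).comp (PresentedGroup.toGroup (braidGen_relator A))

theorem rho_sigma {k : Type*} [CommRing k] (A : kˣ) {n : ℕ} (i : Fin (n - 1)) :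
    rho A n (sigma i) = (A : k) • genU k (loopValue A) i + ((A⁻¹ : kˣ) : k) • 1 := by
  simp [rho, sigma, braidGen]

theorem rho_sigma_inv {k : Type*} [CommRing k] (A : kˣ) {n : ℕ} (i : Fin (n - 1)) :
    rho A n (sigma i)⁻¹ = ((A⁻¹ : kˣ) : k) • genU k (loopValue A) i + (A : k) • 1 := by
  simp only [rho, sigma, MonoidHom.comp_apply, map_inv, PresentedGroup.toGroup.of]
  rfl

/-! ### The matrices of the model

Throughout, `I` is a square root of `-1` in the ground ring. A basis vector of the `n`-fold tensor
power of the two-dimensional space `V` is a function `Fin n → Fin 2`; an upper (row) index of a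
matrix is read at the top of the diagram, a lower (column) index at its bottom. -/

section
variable {k : Type*} [CommRing k] {n : ℕ}

/-- The matrix `M = (M_{ab}) = (M^{ab})` of both the cap and the cup. -/
def matM (I : k) (A : kˣ) : Matrix (Fin 2) (Fin 2) k :=
  !![0, I * A; -I * ((A⁻¹ : kˣ) : k), 0]

/-- The matrix `U^{ab}_{cd} = M^{ab} M_{cd}` of a cup over a cap. -/
def cupCap (I : k) (A : kˣ) : Matrix (Fin 2 × Fin 2) (Fin 2 × Fin 2) k :=
  fun p q => matM I A p.1 p.2 * matM I A q.1 q.2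

/-- The matrix `R^{ab}_{cd} = A M^{ab} M_{cd} + A⁻¹ δ^a_c δ^b_d` of the crossing of `σ_i`. -/
def matR (I : k) (A : kˣ) : Matrix (Fin 2 × Fin 2) (Fin 2 × Fin 2) k :=
  (A : k) • cupCap I A + ((A⁻¹ : kˣ) : k) • 1

/-- The matrix of the crossing of `σ_i⁻¹`; it is the inverse of `matR`, see `matR_mul_matRInv`. -/
def matRInv (I : k) (A : kˣ) : Matrix (Fin 2 × Fin 2) (Fin 2 × Fin 2) k :=
  ((A⁻¹ : kˣ) : k) • cupCap I A + (A : k) • 1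

/-- `η = M Mᵗ`. -/
def eta (I : k) (A : kˣ) : Matrix (Fin 2) (Fin 2) k := matM I A * (matM I A).transpose

/-- The `n`-fold tensor power of a `2 × 2` matrix. -/
def tensorPow (n : ℕ) (X : Matrix (Fin 2) (Fin 2) k) :
    Matrix (Fin n → Fin 2) (Fin n → Fin 2) k :=
  fun a c => ∏ s, X (a s) (c s)

/-- The operator on the `n`-fold tensor power of `V` that acts by `X` on the tensor factors `l` and
`r` and by the identity on all the others. -/
def onStrands (X : Matrix (Fin 2 × Fin 2) (Fin 2 × Fin 2) k) (l r : Fin n) :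
    Matrix (Fin n → Fin 2) (Fin n → Fin 2) k :=
  fun a c => if ∀ s, s ≠ l → s ≠ r → a s = c s then X (a l, a r) (c l, c r) else 0

theorem onStrands_mulVec (X : Matrix (Fin 2 × Fin 2) (Fin 2 × Fin 2) k) {l r : Fin n} (h : l ≠ r)
    (v : (Fin n → Fin 2) → k) (a : Fin n → Fin 2) :
    (onStrands X l r).mulVec v a = ∑ x, ∑ y, X (a l, a r) (x, y) *
      v (Function.update (Function.update a l x) r y) := by
  rw [← Finset.sum_product' (s := Finset.univ) (t := Finset.univ) (f := fun x y =>
    X (a l, a r) (x, y) * v (Function.update (Function.update a l x) r y))]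
  simp only [Matrix.mulVec, dotProduct, onStrands, ite_mul, zero_mul]
  rw [← Finset.sum_filter]
  refine Finset.sum_bij' (fun c _ => (c l, c r))
    (fun p _ => Function.update (Function.update a l p.1) r p.2) ?_ ?_ ?_ ?_ ?_
  · simp
  · intro p _
    simp only [Finset.mem_filter, Finset.mem_univ, true_and]
    intro s h1 h2
    simp [h1, h2]
  · intro c hc
    simp only [Finset.mem_filter, Finset.mem_univ, true_and] at hc
    ext s
    by_cases h2 : s = r
    · subst h2; simp
    · by_cases h1 : s = l
      · subst h1; simp [h2]
      · simp [h1, h2, hc s h1 h2]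
  · intro p _
    simp [h]
  · intro c hc
    simp only [Finset.mem_filter, Finset.mem_univ, true_and] at hc
    congr 2
    ext s
    by_cases h2 : s = r
    · subst h2; simp
    · by_cases h1 : s = l
      · subst h1; simp [h2]
      · simp [h1, h2, hc s h1 h2]

theorem ext_mulVec {m : Type*} [Fintype m] [DecidableEq m] {P Q : Matrix m m k}
    (h : ∀ v a, P.mulVec v a = Q.mulVec v a) : P = Q := by
  apply Matrix.mulVec_injective
  funext v a
  exact h v a

theorem matM_00 (I : k) (A : kˣ) : matM I A 0 0 = 0 := rfl
theorem matM_11 (I : k) (A : kˣ) : matM I A 1 1 = 0 := rfl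
theorem matM_01 (I : k) (A : kˣ) : matM I A 0 1 = I * A := rfl
theorem matM_10 (I : k) (A : kˣ) : matM I A 1 0 = -I * ((A⁻¹ : kˣ) : k) := rfl

theorem cupCap_sq {I : k} (hI : I ^ 2 = -1) (A : kˣ) {l r : Fin n} (h : l ≠ r) :
    onStrands (cupCap I A) l r * onStrands (cupCap I A) l r =
      loopValue A • onStrands (cupCap I A) l r := by
  refine ext_mulVec fun v a => ?_
  have hu (x y z t : Fin 2) : Function.update (Function.update (Function.update (Function.update
      a l x) r y) l z) r t = Function.update (Function.update a l z) r t := by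
    ext s; simp only [Function.update_apply]; split_ifs <;> rfl
  rw [← Matrix.mulVec_mulVec, Matrix.smul_mulVec]
  simp only [Pi.smul_apply, onStrands_mulVec _ h, hu]
  simp [Fin.sum_univ_two, cupCap, matM_00, matM_01, matM_10, matM_11, h, loopValue]
  generalize v _ = p
  generalize v _ = q
  linear_combination (exp := 1) (matM I A (a l) (a r)) * (I * A * p - I * ((A⁻¹ : kˣ) : k) * q) *
    ((A : k) ^ 2 + ((A⁻¹ : kˣ) : k) ^ 2) * hI

theorem cupCap_adj_left {I : k} (hI : I ^ 2 = -1) (A : kˣ) {l m r : Fin n}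
    (h1 : l ≠ m) (h2 : m ≠ r) (h3 : l ≠ r) :
    onStrands (cupCap I A) l m * onStrands (cupCap I A) m r * onStrands (cupCap I A) l m =
      onStrands (cupCap I A) l m := by
  refine ext_mulVec fun v a => ?_
  have hu (x y z t p q : Fin 2) : Function.update (Function.update (Function.update
      (Function.update (Function.update (Function.update a l x) m y) m z) r t) l p) m q =
      Function.update (Function.update (Function.update a l p) m q) r t := by
    ext s; simp only [Function.update_apply]; split_ifs <;> simp_all
  have hv (p q : Fin 2) : Function.update (Function.update a l p) m q =
      Function.update (Function.update (Function.update a l p) m q) r (a r) := by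
    ext s; simp only [Function.update_apply]; split_ifs <;> simp_all
  rw [← Matrix.mulVec_mulVec, ← Matrix.mulVec_mulVec]
  simp only [onStrands_mulVec _ h1, onStrands_mulVec _ h2, hu]
  obtain ⟨g, hg⟩ : ∃ g : Fin 2 → Fin 2 → Fin 2 → k, ∀ p q t, v (Function.update
      (Function.update (Function.update a l p) m q) r t) = g p q t := ⟨_, fun _ _ _ => rfl⟩
  have hg' (p q : Fin 2) : v (Function.update (Function.update a l p) m q) = g p q (a r) := by
    rw [hv, hg]
  simp only [hg, hg']
  have hA : (A : k) * ((A⁻¹ : kˣ) : k) = 1 := A.mul_inv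
  have hq : I ^ 4 * (A : k) ^ 2 * ((A⁻¹ : kˣ) : k) ^ 2 = 1 := by
    linear_combination (I ^ 2 - 1) * (A : k) ^ 2 * ((A⁻¹ : kˣ) : k) ^ 2 * hI +
      ((A : k) * ((A⁻¹ : kˣ) : k) + 1) * hA
  simp only [Fin.sum_univ_two, cupCap, matM_00, matM_01, matM_10, matM_11]
  simp [h1, h2, h2.symm, h3, h3.symm]
  generalize a r = c
  generalize matM I A (a l) (a m) = e
  fin_cases c
  · simp [matM_00, matM_01, matM_10, matM_11]
    linear_combination (exp := 1) e * (I * A * g 0 1 0 - I * ((A⁻¹ : kˣ) : k) * g 1 0 0) * hq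
  · simp [matM_00, matM_01, matM_10, matM_11]
    linear_combination (exp := 1) e * (I * A * g 0 1 1 - I * ((A⁻¹ : kˣ) : k) * g 1 0 1) * hq

theorem cupCap_adj_right {I : k} (hI : I ^ 2 = -1) (A : kˣ) {l m r : Fin n}
    (h1 : l ≠ m) (h2 : m ≠ r) (h3 : l ≠ r) :
    onStrands (cupCap I A) m r * onStrands (cupCap I A) l m * onStrands (cupCap I A) m r =
      onStrands (cupCap I A) m r := by
  refine ext_mulVec fun v a => ?_
  have hu (x y z t p q : Fin 2) : Function.update (Function.update (Function.update
      (Function.update (Function.update (Function.update a m x) r y) l z) m t) m p) r q =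
      Function.update (Function.update (Function.update a m p) r q) l z := by
    ext s; simp only [Function.update_apply]; split_ifs <;> simp_all
  have hv (p q : Fin 2) : Function.update (Function.update a m p) r q =
      Function.update (Function.update (Function.update a m p) r q) l (a l) := by
    ext s; simp only [Function.update_apply]; split_ifs <;> simp_all
  rw [← Matrix.mulVec_mulVec, ← Matrix.mulVec_mulVec]
  simp only [onStrands_mulVec _ h1, onStrands_mulVec _ h2, hu]
  obtain ⟨g, hg⟩ : ∃ g : Fin 2 → Fin 2 → Fin 2 → k, ∀ p q t, v (Function.update
      (Function.update (Function.update a m p) r q) l t) = g p q t := ⟨_, fun _ _ _ => rfl⟩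
  have hg' (p q : Fin 2) : v (Function.update (Function.update a m p) r q) = g p q (a l) := by
    rw [hv, hg]
  simp only [hg, hg']
  have hA : (A : k) * ((A⁻¹ : kˣ) : k) = 1 := A.mul_inv
  have hq : I ^ 4 * (A : k) ^ 2 * ((A⁻¹ : kˣ) : k) ^ 2 = 1 := by
    linear_combination (I ^ 2 - 1) * (A : k) ^ 2 * ((A⁻¹ : kˣ) : k) ^ 2 * hI +
      ((A : k) * ((A⁻¹ : kˣ) : k) + 1) * hA
  simp only [Fin.sum_univ_two, cupCap, matM_00, matM_01, matM_10, matM_11]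
  simp [h1, h2, h2.symm, h3, h3.symm]
  generalize a l = c
  generalize matM I A (a m) (a r) = e
  fin_cases c
  · simp [matM_00, matM_01, matM_10, matM_11]
    linear_combination (exp := 1) e * (I * A * g 0 1 0 - I * ((A⁻¹ : kˣ) : k) * g 1 0 0) * hq
  · simp [matM_00, matM_01, matM_10, matM_11]
    linear_combination (exp := 1) e * (I * A * g 0 1 1 - I * ((A⁻¹ : kˣ) : k) * g 1 0 1) * hq

theorem cupCap_comm (I : k) (A : kˣ) {l r l' r' : Fin n} (h : l ≠ r) (h' : l' ≠ r')
    (h1 : l ≠ l') (h2 : l ≠ r') (h3 : r ≠ l') (h4 : r ≠ r') :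
    onStrands (cupCap I A) l r * onStrands (cupCap I A) l' r' =
      onStrands (cupCap I A) l' r' * onStrands (cupCap I A) l r := by
  refine ext_mulVec fun v a => ?_
  have hu (x y z t : Fin 2) : Function.update (Function.update (Function.update
      (Function.update a l x) r y) l' z) r' t = Function.update (Function.update (Function.update
      (Function.update a l' z) r' t) l x) r y := by
    ext s; simp only [Function.update_apply]; split_ifs <;> simp_all
  rw [← Matrix.mulVec_mulVec, ← Matrix.mulVec_mulVec]
  simp only [onStrands_mulVec _ h, onStrands_mulVec _ h', hu]
  generalize hg : (fun x y z t => v (Function.update (Function.update (Function.update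
      (Function.update a l' z) r' t) l x) r y)) = g
  have hg' (x y z t : Fin 2) : v (Function.update (Function.update (Function.update
      (Function.update a l' z) r' t) l x) r y) = g x y z t := by rw [← hg]
  simp only [hg']
  simp [Fin.sum_univ_two, cupCap, matM_00, matM_01, matM_10, matM_11, h1, h1.symm, h2, h2.symm,
      h3, h3.symm, h4, h4.symm]
  ring1

theorem matR_mul_matRInv {I : k} (hI : I ^ 2 = -1) (A : kˣ) : matR I A * matRInv I A = 1 := by
  refine aux_inv A.mul_inv (d := loopValue A) rfl ?_
  ext p q
  simp [Matrix.mul_apply, Fintype.sum_prod_type, cupCap, matM_00, matM_01, matM_10, matM_11,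
    loopValue]
  linear_combination (exp := 1) matM I A p.1 p.2 * matM I A q.1 q.2 *
    ((A : k) ^ 2 + ((A⁻¹ : kˣ) : k) ^ 2) * hI

theorem cupCap_rel {I : k} (hI : I ^ 2 = -1) (A : kˣ) (n : ℕ) ⦃x y : FreeAlgebra k (Fin (n - 1))⦄
    (h : TLRel k (loopValue A) n x y) :
    FreeAlgebra.lift k (fun i => onStrands (cupCap I A) (left i) (right i)) x =
      FreeAlgebra.lift k (fun i => onStrands (cupCap I A) (left i) (right i)) y := by
  rcases h with i | ⟨i, j, h⟩ | ⟨i, j, h⟩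
  · simpa using cupCap_sq hI A (left_ne_right i)
  · simp only [map_mul, FreeAlgebra.lift_ι_apply]
    rcases h with h | h
    · have e : left j = right i := by simp [left, right, h]
      rw [e]
      refine cupCap_adj_left hI A ?_ ?_ ?_ <;> simp [left, right, Fin.ext_iff] <;> omega
    · have e : left i = right j := by simp [left, right, h]
      rw [e]
      refine cupCap_adj_right hI A ?_ ?_ ?_ <;> simp [left, right, Fin.ext_iff] <;> omega
  · simp only [map_mul, FreeAlgebra.lift_ι_apply]
    refine cupCap_comm I A ?_ ?_ ?_ ?_ ?_ ?_ <;> simp [left, right, Fin.ext_iff] <;> omega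

/-- The matrix representation of the Temperley–Lieb algebra: `U_i` acts by `M^{ab} M_{cd}` on the
tensor factors `i` and `i + 1` and by the identity on the others. -/
def tlMatrix {I : k} (hI : I ^ 2 = -1) (A : kˣ) (n : ℕ) :
    TemperleyLieb k (loopValue A) n →ₐ[k] Matrix (Fin n → Fin 2) (Fin n → Fin 2) k :=
  RingQuot.liftAlgHom k ⟨FreeAlgebra.lift k fun i => onStrands (cupCap I A) (left i) (right i),
    cupCap_rel hI A n⟩

theorem tlMatrix_genU {I : k} (hI : I ^ 2 = -1) (A : kˣ) (i : Fin (n - 1)) :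
    tlMatrix hI A n (genU k (loopValue A) i) = onStrands (cupCap I A) (left i) (right i) := by
  simp [tlMatrix, genU]

theorem onStrands_one {l r : Fin n} :
    onStrands (1 : Matrix (Fin 2 × Fin 2) (Fin 2 × Fin 2) k) l r = 1 := by
  ext a c
  simp only [onStrands, Matrix.one_apply, ← ite_and, Prod.mk.injEq]
  congr 1
  refine propext ⟨fun h => funext fun s => ?_, fun h => by simp [h]⟩
  by_cases h1 : s = l
  · rw [h1]; exact h.2.1
  · by_cases h2 : s = r
    · rw [h2]; exact h.2.2
    · exact h.1 s h1 h2

/-- `σ_i` acts by `R` on the tensor factors `i` and `i + 1`. -/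
theorem tlMatrix_rho_sigma {I : k} (hI : I ^ 2 = -1) (A : kˣ) (i : Fin (n - 1)) :
    tlMatrix hI A n (rho A n (sigma i)) = onStrands (matR I A) (left i) (right i) := by
  rw [rho_sigma, map_add, map_smul, map_smul, tlMatrix_genU, map_one,
    ← onStrands_one (l := left i) (r := right i)]
  ext a c
  simp only [onStrands, matR, Matrix.add_apply, Matrix.smul_apply]
  split_ifs <;> simp

end

/-! ### Diagrams, the bracket and the amplitude -/

/-- An unoriented link diagram in general position with respect to the vertical direction: it is
cut into edges that run vertically, and the edges meet at maxima, minima, crossings, and joints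
(points that subdivide a vertical strand). Every edge has one upper and one lower end. The crossing
`c` has the four corners `nw c`, `ne c`, `sw c`, `se c`; if `positive c = true`, its overstrand runs
from north-west to south-east, otherwise from north-east to south-west. Planarity of the diagram is
not recorded, as neither the bracket nor the amplitude refers to it. -/
structure MorseDiagram where
  Edge : Type
  Maximum : Type
  Minimum : Type
  Crossing : Type
  Joint : Type
  [fintypeEdge : Fintype Edge]
  [decEqEdge : DecidableEq Edge]
  [fintypeMaximum : Fintype Maximum]
  [fintypeMinimum : Fintype Minimum]
  [fintypeCrossing : Fintype Crossing]
  [decEqCrossing : DecidableEq Crossing]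
  [fintypeJoint : Fintype Joint]
  maxLeft : Maximum → Edge
  maxRight : Maximum → Edge
  minLeft : Minimum → Edge
  minRight : Minimum → Edge
  nw : Crossing → Edge
  ne : Crossing → Edge
  sw : Crossing → Edge
  se : Crossing → Edge
  positive : Crossing → Bool
  above : Joint → Edge
  below : Joint → Edge
  upper_end : Function.Bijective
    (Sum.elim maxLeft (Sum.elim maxRight (Sum.elim sw (Sum.elim se below))))
  lower_end : Function.Bijective
    (Sum.elim minLeft (Sum.elim minRight (Sum.elim nw (Sum.elim ne above))))

attribute [instance] MorseDiagram.fintypeEdge MorseDiagram.decEqEdge MorseDiagram.fintypeMaximum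
  MorseDiagram.fintypeMinimum MorseDiagram.fintypeCrossing MorseDiagram.decEqCrossing
  MorseDiagram.fintypeJoint

namespace MorseDiagram

/-- A state chooses a smoothing of every crossing: `true` is the `A`-smoothing (which joins the
two regions that the overstrand sweeps out when it is turned counterclockwise) and `false` is the
`B`-smoothing. -/
abbrev State (D : MorseDiagram) : Type := D.Crossing → Bool

/-- Two edges that are joined at a point of the diagram after every crossing `c` is smoothed as
prescribed by `S`. The smoothing is horizontal (a cup over a cap) if it is the `A`-smoothing of a
positive crossing or the `B`-smoothing of a negative one, and it is vertical otherwise. -/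
inductive Joined (D : MorseDiagram) (S : D.State) : D.Edge → D.Edge → Prop
  | maximum (m : D.Maximum) : Joined D S (D.maxLeft m) (D.maxRight m)
  | minimum (m : D.Minimum) : Joined D S (D.minLeft m) (D.minRight m)
  | joint (j : D.Joint) : Joined D S (D.above j) (D.below j)
  | cup (c : D.Crossing) (h : S c = D.positive c) : Joined D S (D.nw c) (D.ne c)
  | cap (c : D.Crossing) (h : S c = D.positive c) : Joined D S (D.sw c) (D.se c)
  | west (c : D.Crossing) (h : S c ≠ D.positive c) : Joined D S (D.nw c) (D.sw c)
  | east (c : D.Crossing) (h : S c ≠ D.positive c) : Joined D S (D.ne c) (D.se c)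

/-- The number `‖S‖` of loops of a state: the classes of edges under the equivalence relation
generated by `Joined`. -/
noncomputable def loops (D : MorseDiagram) (S : D.State) : ℕ := Nat.card (Quot (D.Joined S))

/-- The bracket `⟨K⟩ = ∑_S ⟨K|S⟩ δ^(‖S‖ - 1)`, where `⟨K|S⟩` is the product of the vertex weights
`A` and `A⁻¹`. -/
noncomputable def bracket {k : Type*} [CommRing k] (A : kˣ) (D : MorseDiagram) : k :=
  ∑ S : D.State, (∏ c, if S c then (A : k) else ((A⁻¹ : kˣ) : k)) *
    loopValue A ^ (D.loops S - 1)

/-- The amplitude `Z(K)`: the abstract tensor expression of the diagram, with `M_{ab}` at the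
maxima, `M^{ab}` at the minima, `R` and `R⁻¹` at the crossings and Kronecker deltas at the joints,
summed over all values of all indices. -/
def amplitude {k : Type*} [CommRing k] (I : k) (A : kˣ) (D : MorseDiagram) : k :=
  ∑ f : D.Edge → Fin 2,
    (∏ m, matM I A (f (D.maxLeft m)) (f (D.maxRight m))) *
    (∏ m, matM I A (f (D.minLeft m)) (f (D.minRight m))) *
    (∏ c, (if D.positive c then matR I A else matRInv I A)
      (f (D.nw c), f (D.ne c)) (f (D.sw c), f (D.se c))) *
    ∏ j, if f (D.above j) = f (D.below j) then 1 else 0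

end MorseDiagram

/-! ### Closures

In both closures below the edges are the pieces `(j, s)` of the strand positions `s` at the levels
`j = 0, …, length w` (numbered from top to bottom), and the `n` returning strands. The letter number
`j` of the word sits between the levels `j` and `j + 1`. For each `s`, a maximum joins the top of
strand `s` to the top of the returning strand `s`, and a minimum joins their bottoms. -/

/-- The closure of a braid word. -/
def BraidWord.closure {n : ℕ} (w : BraidWord n) : MorseDiagram where
  Edge := (Fin (w.length + 1) × Fin n) ⊕ Fin n
  Maximum := Fin n
  Minimum := Fin n
  Crossing := Fin w.length
  Joint := {p : Fin w.length × Fin n // p.2 ≠ left (w.get p.1).1 ∧ p.2 ≠ right (w.get p.1).1}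
  maxLeft s := .inl (0, s)
  maxRight s := .inr s
  minLeft s := .inl (Fin.last _, s)
  minRight s := .inr s
  nw j := .inl (j.castSucc, left (w.get j).1)
  ne j := .inl (j.castSucc, right (w.get j).1)
  sw j := .inl (j.succ, left (w.get j).1)
  se j := .inl (j.succ, right (w.get j).1)
  positive j := (w.get j).2
  above p := .inl (p.1.1.castSucc, p.1.2)
  below p := .inl (p.1.1.succ, p.1.2)
  upper_end := by
    constructor
    · rintro (s | s | c | c | ⟨⟨j, s⟩, h1, h2⟩) (s' | s' | c' | c' | ⟨⟨j', s'⟩, h1', h2'⟩) h <;>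
        simp only [Sum.elim_inl, Sum.elim_inr, Sum.inl.injEq, Sum.inr.injEq, Prod.mk.injEq,
          reduceCtorEq, Fin.succ_inj, Fin.succ_ne_zero, (Fin.succ_ne_zero _).symm,
          false_and] at h <;>
        grind [left_ne_right]
    · rintro (⟨l, s⟩ | s)
      · induction l using Fin.cases with
        | zero => exact ⟨.inl s, rfl⟩
        | succ j =>
          by_cases h1 : s = left (w.get j).1
          · exact ⟨.inr (.inr (.inl j)), by simp [h1]⟩
          · by_cases h2 : s = right (w.get j).1
            · exact ⟨.inr (.inr (.inr (.inl j))), by simp [h2]⟩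
            · exact ⟨.inr (.inr (.inr (.inr ⟨(j, s), h1, h2⟩))), rfl⟩
      · exact ⟨.inr (.inl s), rfl⟩
  lower_end := by
    constructor
    · rintro (s | s | c | c | ⟨⟨j, s⟩, h1, h2⟩) (s' | s' | c' | c' | ⟨⟨j', s'⟩, h1', h2'⟩) h <;>
        simp only [Sum.elim_inl, Sum.elim_inr, Sum.inl.injEq, Sum.inr.injEq, Prod.mk.injEq,
          reduceCtorEq, Fin.castSucc_inj, Fin.castSucc_ne_last, (Fin.castSucc_ne_last _).symm,
          false_and] at h <;>
        grind [left_ne_right]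
    · rintro (⟨l, s⟩ | s)
      · induction l using Fin.lastCases with
        | last => exact ⟨.inl s, rfl⟩
        | cast j =>
          by_cases h1 : s = left (w.get j).1
          · exact ⟨.inr (.inr (.inl j)), by simp [h1]⟩
          · by_cases h2 : s = right (w.get j).1
            · exact ⟨.inr (.inr (.inr (.inl j))), by simp [h2]⟩
            · exact ⟨.inr (.inr (.inr (.inr ⟨(j, s), h1, h2⟩))), rfl⟩
      · exact ⟨.inr (.inl s), rfl⟩

/-- The closure of the diagram of the product `U_{i_1} U_{i_2} ⋯` for a word `i_1, i_2, …`: each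
letter is a cup over a cap. -/
def tlClosure {n : ℕ} (w : List (Fin (n - 1))) : MorseDiagram where
  Edge := (Fin (w.length + 1) × Fin n) ⊕ Fin n
  Maximum := Fin n ⊕ Fin w.length
  Minimum := Fin n ⊕ Fin w.length
  Crossing := Empty
  Joint := {p : Fin w.length × Fin n // p.2 ≠ left (w.get p.1) ∧ p.2 ≠ right (w.get p.1)}
  maxLeft := Sum.elim (fun s => .inl (0, s)) (fun j => .inl (j.succ, left (w.get j)))
  maxRight := Sum.elim .inr (fun j => .inl (j.succ, right (w.get j)))
  minLeft := Sum.elim (fun s => .inl (Fin.last _, s)) (fun j => .inl (j.castSucc, left (w.get j)))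
  minRight := Sum.elim .inr (fun j => .inl (j.castSucc, right (w.get j)))
  nw := Empty.elim
  ne := Empty.elim
  sw := Empty.elim
  se := Empty.elim
  positive := Empty.elim
  above p := .inl (p.1.1.castSucc, p.1.2)
  below p := .inl (p.1.1.succ, p.1.2)
  upper_end := by
    constructor
    · rintro ((s | c) | (s | c) | c | c | ⟨⟨j, s⟩, h1, h2⟩)
        ((s' | c') | (s' | c') | c' | c' | ⟨⟨j', s'⟩, h1', h2'⟩) h <;>
        simp only [Sum.elim_inl, Sum.elim_inr, Sum.inl.injEq, Sum.inr.injEq, Prod.mk.injEq,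
          reduceCtorEq, Fin.succ_inj, Fin.succ_ne_zero, (Fin.succ_ne_zero _).symm,
          false_and] at h <;>
        grind [left_ne_right]
    · rintro (⟨l, s⟩ | s)
      · induction l using Fin.cases with
        | zero => exact ⟨.inl (.inl s), rfl⟩
        | succ j =>
          by_cases h1 : s = left (w.get j)
          · exact ⟨.inl (.inr j), by simp [h1]⟩
          · by_cases h2 : s = right (w.get j)
            · exact ⟨.inr (.inl (.inr j)), by simp [h2]⟩
            · exact ⟨.inr (.inr (.inr (.inr ⟨(j, s), h1, h2⟩))), rfl⟩
      · exact ⟨.inr (.inl (.inl s)), rfl⟩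
  lower_end := by
    constructor
    · rintro ((s | c) | (s | c) | c | c | ⟨⟨j, s⟩, h1, h2⟩)
        ((s' | c') | (s' | c') | c' | c' | ⟨⟨j', s'⟩, h1', h2'⟩) h <;>
        simp only [Sum.elim_inl, Sum.elim_inr, Sum.inl.injEq, Sum.inr.injEq, Prod.mk.injEq,
          reduceCtorEq, Fin.castSucc_inj, Fin.castSucc_ne_last, (Fin.castSucc_ne_last _).symm,
          false_and] at h <;>
        grind [left_ne_right]
    · rintro (⟨l, s⟩ | s)
      · induction l using Fin.lastCases with
        | last => exact ⟨.inl (.inl s), rfl⟩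
        | cast j =>
          by_cases h1 : s = left (w.get j)
          · exact ⟨.inl (.inr j), by simp [h1]⟩
          · by_cases h2 : s = right (w.get j)
            · exact ⟨.inr (.inl (.inr j)), by simp [h2]⟩
            · exact ⟨.inr (.inr (.inr (.inr ⟨(j, s), h1, h2⟩))), rfl⟩
      · exact ⟨.inr (.inl (.inl s)), rfl⟩

/-- The product `U_{i_1} U_{i_2} ⋯` in `TL_n`. -/
def connectionElement {k : Type*} [CommRing k] (d : k) {n : ℕ} (w : List (Fin (n - 1))) :
    TemperleyLieb k d n :=
  (w.map (genU k d)).prod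

/-- The number `λ(Q)` of loops in the closure of the diagram of `Q = U_{i_1} U_{i_2} ⋯`. -/
noncomputable def closureLoops {n : ℕ} (w : List (Fin (n - 1))) : ℕ :=
  (tlClosure w).loops Empty.elim

end BraidTrace

open BraidTrace

namespace BraidTrace

/-! ### A normal form for words in the Temperley–Lieb generators -/

section NormalForm
variable {G : Type*} [Monoid G] {U : ℕ → G} {d : G}

/-! The trace weighted by η^{⊗n} is a Markov trace. Up to powers of δ, a word in the generators
contains the last one at most once (`exists_normalForm`). The partial trace over the last strand
then either produces a factor δ or erases that single generator, so recursion on n shows that the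
weighted trace of every word is some power δ^e (`exists_trace_eq_pow`).

Identifying e needs no planar topology. In k the value δ^e need not determine e, so the recursion is
run over a product ring, which yields one exponent valid in both factors
(`exists_trace_smoothed_eq_pow`). The second factor is ℂ with A = i: there δ = 2, η = 1, and M is
zero on the diagonal and -1 off it. Hence U is a 0/1 matrix that asks for unequal indices at the cup
and at the cap. Adding the parity of the strand position to every index turns "unequal" into
"equal", and the trace counts the index assignments that are constant on loops. There are 2^loops of
them, so 2^e = 2^loops and e is the number of loops (`trace_smoothed_eq_pow`).

For a closed braid, summing over the indices of the returning strands puts one η at each position,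
and the rest of the amplitude is a product of transfer matrices (`sum_closure`,
`amplitude_closure`). Expanding each R or R⁻¹ into its two smoothings turns the same trace into the
state sum with δ^‖S‖ in place of δ^(‖S‖-1), which is δ⟨K⟩ (`loopValue_mul_bracket_closure`). -/

theorem commute_of_mem_closure_Iio {m : ℕ}
    (hcomm : ∀ i, i < m → U i * U (m + 1) = U (m + 1) * U i) {x : G}
    (hx : x ∈ Submonoid.closure (U '' Set.Iio m)) : Commute x (U (m + 1)) := by
  induction hx using Submonoid.closure_induction with
  | mem x hx =>
    obtain ⟨i, hi, rfl⟩ := hx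
    exact hcomm i hi
  | one => exact Commute.one_left _
  | mul x y _ _ hx hy => exact hx.mul_left hy

theorem generator_mem_closure_Iio {i m : ℕ} (h : i < m) :
    U i ∈ Submonoid.closure (U '' Set.Iio m) :=
  Submonoid.subset_closure ⟨i, h, rfl⟩

theorem closure_Iio_mono {m m' : ℕ} (h : m ≤ m') :
    Submonoid.closure (U '' Set.Iio m) ≤ Submonoid.closure (U '' Set.Iio m') :=
  Submonoid.closure_mono (Set.image_mono (Set.Iio_subset_Iio h))

/-- The normal forms are stable under left multiplication by a generator as soon as two factors `U
m` with earlier generators between them can be merged into one. That merging is the hypothesis `hm`.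
-/
theorem exists_normalForm_of_sandwich (hd : ∀ x, Commute d x) {m : ℕ}
    (hm : ∀ x ∈ Submonoid.closure (U '' Set.Iio m), ∃ e : ℕ,
      ∃ y ∈ Submonoid.closure (U '' Set.Iio m), ∃ z ∈ Submonoid.closure (U '' Set.Iio m),
        U m * x * U m = d ^ e * (y * U m * z))
    {x : G} (hx : x ∈ Submonoid.closure (U '' Set.Iio (m + 1))) :
    ∃ e : ℕ, (∃ y ∈ Submonoid.closure (U '' Set.Iio m), x = d ^ e * y) ∨
      ∃ y ∈ Submonoid.closure (U '' Set.Iio m), ∃ z ∈ Submonoid.closure (U '' Set.Iio m),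
        x = d ^ e * (y * U m * z) := by
  induction hx using Submonoid.closure_induction_left with
  | one => exact ⟨0, .inl ⟨1, one_mem _, by simp⟩⟩
  | mul_left g hg x _ ih =>
    obtain ⟨i, hi, rfl⟩ := hg
    have hc (e : ℕ) (y : G) : U i * (d ^ e * y) = d ^ e * (U i * y) := by
      rw [← mul_assoc, ← ((hd (U i)).pow_left e).eq, mul_assoc]
    rcases Nat.lt_succ_iff_lt_or_eq.1 (Set.mem_Iio.1 hi) with hi | rfl
    · have hU := generator_mem_closure_Iio (U := U) hi
      obtain ⟨e, ⟨y, hy, rfl⟩ | ⟨y, hy, z, hz, rfl⟩⟩ := ih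
      · exact ⟨e, .inl ⟨U i * y, mul_mem hU hy, hc e y⟩⟩
      · exact ⟨e, .inr ⟨U i * y, mul_mem hU hy, z, hz, by rw [hc]; simp only [mul_assoc]⟩⟩
    · obtain ⟨e, ⟨y, hy, rfl⟩ | ⟨y, hy, z, hz, rfl⟩⟩ := ih
      · exact ⟨e, .inr ⟨1, one_mem _, y, hy, by rw [hc, one_mul]⟩⟩
      · obtain ⟨e', y', hy', z', hz', h⟩ := hm y hy
        refine ⟨e + e', .inr ⟨y', hy', z' * z, mul_mem hz' hz, ?_⟩⟩
        rw [hc, ← mul_assoc (U i), ← mul_assoc (U i), h, pow_add]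
        simp only [mul_assoc]

/-- Every product of `U_0, …, U_m` is, up to a power of `d`, a product of the generators before
`U_m` or has exactly one factor `U_m`. -/
theorem exists_normalForm (hd : ∀ x, Commute d x) {b : ℕ}
    (hsq : ∀ i < b, U i * U i = d * U i)
    (hadj : ∀ i, i + 1 < b → U (i + 1) * U i * U (i + 1) = U (i + 1))
    (hcomm : ∀ i j, i + 1 < j → j < b → U i * U j = U j * U i) {m : ℕ} (hmb : m < b)
    {x : G} (hx : x ∈ Submonoid.closure (U '' Set.Iio (m + 1))) :
    ∃ e : ℕ, (∃ y ∈ Submonoid.closure (U '' Set.Iio m), x = d ^ e * y) ∨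
      ∃ y ∈ Submonoid.closure (U '' Set.Iio m), ∃ z ∈ Submonoid.closure (U '' Set.Iio m),
        x = d ^ e * (y * U m * z) := by
  induction m generalizing x with
  | zero =>
    -- There is no generator before `U 0`, so the sandwich is just `U 0 * U 0`; the exponent 1 comes
    -- from the square relation.
    refine exists_normalForm_of_sandwich hd (fun x hx => ⟨1, 1, one_mem _, 1, one_mem _, ?_⟩) hx
    have : x = 1 := by simpa [Submonoid.mem_bot] using hx
    simp [this, hsq 0 hmb]
  | succ m ih =>
    refine exists_normalForm_of_sandwich hd (fun x hx => ?_) hx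
    have hle := closure_Iio_mono (U := U) m.le_succ
    have hU {v : G} (hv : v ∈ Submonoid.closure (U '' Set.Iio m)) : U (m + 1) * v = v * U (m + 1) :=
      (commute_of_mem_closure_Iio (fun i hi => hcomm i _ (by omega) hmb) hv).eq.symm
    have hc (e : ℕ) (y : G) : U (m + 1) * (d ^ e * y) = d ^ e * (U (m + 1) * y) := by
      rw [← mul_assoc, ← ((hd _).pow_left e).eq, mul_assoc]
    obtain ⟨e, ⟨y, hy, rfl⟩ | ⟨y, hy, z, hz, rfl⟩⟩ := ih (by omega) hx
    -- Without `U m` in the middle, `U (m + 1)` passes through `y` and is squared, which costs one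
    -- more `d`.
    · refine ⟨e + 1, y, hle hy, 1, one_mem _, ?_⟩
      rw [hc, hU hy, mul_assoc, mul_assoc, hsq _ hmb, pow_succ, mul_one, mul_assoc, ← mul_assoc y,
        ← (hd y).eq, mul_assoc]
    -- Both outer factors `U (m + 1)` move inward past `y` and `z` until they enclose the single `U
    -- m`, where the adjacency relation applies.
    · refine ⟨e, y, hle hy, z, hle hz, ?_⟩
      rw [hc, mul_assoc, ← mul_assoc (U (m + 1)), ← mul_assoc (U (m + 1)), hU hy,
        mul_assoc _ z, ← hU hz]
      congr 1
      calc _ = y * (U (m + 1) * U m * U (m + 1)) * z := by simp only [mul_assoc]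
        _ = _ := by rw [hadj m hmb]

end NormalForm

/-! ### The Markov property of the trace -/

section Markov
variable {k : Type*} [CommRing k] {n : ℕ}

theorem sum_snoc {α : Type*} [AddCommMonoid α] (F : (Fin (n + 1) → Fin 2) → α) :
    ∑ a, F a = ∑ a : Fin n → Fin 2, ∑ x, F (Fin.snoc a x) := by
  rw [← (Fin.snocEquiv fun _ => Fin 2).sum_comp, Fintype.sum_prod_type_right]
  rfl

/-- The operator `X ⊗ 1` on the `(n + 1)`-st tensor power. -/
def addStrand (X : Matrix (Fin n → Fin 2) (Fin n → Fin 2) k) :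
    Matrix (Fin (n + 1) → Fin 2) (Fin (n + 1) → Fin 2) k :=
  fun a c => X (Fin.init a) (Fin.init c) * if a (Fin.last n) = c (Fin.last n) then 1 else 0

theorem addStrand_mul_apply (X : Matrix (Fin n → Fin 2) (Fin n → Fin 2) k)
    (Z : Matrix (Fin (n + 1) → Fin 2) (Fin (n + 1) → Fin 2) k) (a : Fin n → Fin 2) (x : Fin 2)
    (c : Fin (n + 1) → Fin 2) :
    (addStrand X * Z) (Fin.snoc a x) c = ∑ b, X a b * Z (Fin.snoc b x) c := by
  simp [Matrix.mul_apply, sum_snoc, addStrand]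

theorem mul_addStrand_apply (X : Matrix (Fin n → Fin 2) (Fin n → Fin 2) k)
    (Z : Matrix (Fin (n + 1) → Fin 2) (Fin (n + 1) → Fin 2) k) (a : Fin (n + 1) → Fin 2)
    (c : Fin n → Fin 2) (x : Fin 2) :
    (Z * addStrand X) a (Fin.snoc c x) = ∑ b, Z a (Fin.snoc b x) * X b c := by
  simp [Matrix.mul_apply, sum_snoc, addStrand]

/-- `addStrand` as a homomorphism of monoids. -/
def addStrandHom : Matrix (Fin n → Fin 2) (Fin n → Fin 2) k →*
    Matrix (Fin (n + 1) → Fin 2) (Fin (n + 1) → Fin 2) k where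
  toFun := addStrand
  map_one' := by
    ext a c
    induction a using Fin.snocCases with | snoc a x => ?_
    induction c using Fin.snocCases with | snoc c y => ?_
    simp only [addStrand, Matrix.one_apply, Fin.init_snoc, Fin.snoc_last, Fin.snoc_inj]
    split_ifs <;> simp_all
  map_mul' X Y := by
    ext a c
    induction a using Fin.snocCases with | snoc a x => ?_
    induction c using Fin.snocCases with | snoc c y => ?_
    rw [addStrand_mul_apply]
    simp [addStrand, Matrix.mul_apply]

/-- The partial trace over the last strand, weighted by `N`. -/
def partialTrace (N : Matrix (Fin 2) (Fin 2) k)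
    (Z : Matrix (Fin (n + 1) → Fin 2) (Fin (n + 1) → Fin 2) k) :
    Matrix (Fin n → Fin 2) (Fin n → Fin 2) k :=
  fun a c => ∑ x, ∑ y, N x y * Z (Fin.snoc a y) (Fin.snoc c x)

/-- The weight is a pure tensor, so the last strand can be traced out before the others. -/
theorem trace_tensorPow_succ (N : Matrix (Fin 2) (Fin 2) k)
    (Z : Matrix (Fin (n + 1) → Fin 2) (Fin (n + 1) → Fin 2) k) :
    Matrix.trace (tensorPow (n + 1) N * Z) = Matrix.trace (tensorPow n N * partialTrace N Z) := by
  simp only [Matrix.trace, Matrix.diag, Matrix.mul_apply, sum_snoc, tensorPow, partialTrace,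
    Fin.prod_univ_castSucc, Fin.snoc_castSucc, Fin.snoc_last, Finset.mul_sum]
  refine Finset.sum_congr rfl fun a _ => ?_
  rw [Finset.sum_comm]
  simp only [mul_assoc]

/-- Operators that leave the last strand alone pass through its partial trace, which is thus a
bimodule map. -/
theorem partialTrace_sandwich (N : Matrix (Fin 2) (Fin 2) k)
    (X Y : Matrix (Fin n → Fin 2) (Fin n → Fin 2) k)
    (Z : Matrix (Fin (n + 1) → Fin 2) (Fin (n + 1) → Fin 2) k) :
    partialTrace N (addStrand X * Z * addStrand Y) = X * partialTrace N Z * Y := by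
  ext a c
  simp only [partialTrace, mul_addStrand_apply, addStrand_mul_apply]
  simp only [Matrix.mul_apply, partialTrace, Finset.mul_sum, Finset.sum_mul, Fin.sum_univ_two,
    ← Finset.sum_add_distrib]
  refine Finset.sum_congr rfl fun b _ => Finset.sum_congr rfl fun b' _ => ?_
  ring

theorem partialTrace_one (N : Matrix (Fin 2) (Fin 2) k) :
    partialTrace N (1 : Matrix (Fin (n + 1) → Fin 2) (Fin (n + 1) → Fin 2) k) =
      N.trace • (1 : Matrix (Fin n → Fin 2) (Fin n → Fin 2) k) := by
  ext a c
  simp only [partialTrace, Matrix.one_apply, Fin.snoc_inj, Matrix.smul_apply, Matrix.trace,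
    Matrix.diag, Fin.sum_univ_two]
  by_cases h : a = c <;> simp [h]

/-- The operator of the generator `U_i` on the `n`-fold tensor power. -/
def matU (I : k) (A : kˣ) (n i : ℕ) : Matrix (Fin n → Fin 2) (Fin n → Fin 2) k :=
  if h : i + 1 < n then onStrands (cupCap I A) ⟨i, by omega⟩ ⟨i + 1, h⟩ else 1

theorem matM_mul_self {I : k} (hI : I ^ 2 = -1) (A : kˣ) : matM I A * matM I A = 1 := by
  ext i j
  fin_cases i <;> fin_cases j <;>
    simp [matM, Matrix.mul_apply, Fin.sum_univ_two] <;>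
    linear_combination (-1 : k) * hI - I ^ 2 * A.mul_inv

theorem trace_eta {I : k} (hI : I ^ 2 = -1) (A : kˣ) : (eta I A).trace = loopValue A := by
  simp only [eta, Matrix.trace, Matrix.diag, Matrix.mul_apply, Fin.sum_univ_two,
    Matrix.transpose_apply, matM_00, matM_01, matM_10, matM_11, loopValue]
  linear_combination ((A : k) ^ 2 + ((A⁻¹ : kˣ) : k) ^ 2) * hI

/-- Closing the last strand of the last generator straightens it into a vertical strand.
Algebraically, the surviving 2 × 2 matrix is M ηᵗ Mᵗ = (M M)(M M)ᵗ, and M M = 1. -/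
theorem partialTrace_matU {I : k} (hI : I ^ 2 = -1) (A : kˣ) :
    partialTrace (eta I A) (matU I A (n + 2) n) = 1 := by
  have hM := matM_mul_self hI A
  have h1 : matM I A * eta I A * (matM I A).transpose = 1 := by
    rw [eta, ← mul_assoc, hM, one_mul, ← Matrix.transpose_mul, hM, Matrix.transpose_one]
  have h2 : (eta I A).transpose = eta I A := by simp [eta]
  ext a c
  have h3 := congrFun (congrFun h1 (a (Fin.last n))) (c (Fin.last n))
  have h4 := congrFun (congrFun h2 0) 1
  simp only [Matrix.transpose_apply] at h4
  have hU : matU I A (n + 2) n =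
      onStrands (cupCap I A) (Fin.last n).castSucc (Fin.last (n + 1)) := dif_pos (by omega)
  have h5 (x y : Fin 2) : (∀ s : Fin (n + 2), s ≠ (Fin.last n).castSucc → s ≠ Fin.last (n + 1) →
      (Fin.snoc a y : Fin (n + 2) → Fin 2) s = (Fin.snoc c x : Fin (n + 2) → Fin 2) s) ↔
      ∀ s, s ≠ Fin.last n → a s = c s := by
    constructor
    · intro h s hs
      simpa using h s.castSucc (by simpa using hs) (Fin.castSucc_ne_last s)
    · intro h s hs hs'
      induction s using Fin.lastCases with
      | last => exact absurd rfl hs'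
      | cast s => simpa using h s (by simpa using hs)
  simp only [partialTrace, hU, onStrands, h5,
    Fin.snoc_castSucc, Fin.snoc_last, cupCap, Fin.sum_univ_two]
  simp only [Matrix.mul_apply, Fin.sum_univ_two, Matrix.transpose_apply] at h3
  split_ifs with h
  -- The first `n` indices already agree, so only the 2 × 2 identity `h3` on the remaining strand is
  -- left.
  · have : a = c ↔ a (Fin.last n) = c (Fin.last n) := by
      refine ⟨fun h => h ▸ rfl, fun h' => funext fun s => ?_⟩
      by_cases hs : s = Fin.last n
      · rw [hs, h']
      · exact h s hs
    rw [Matrix.one_apply, if_congr this rfl rfl, ← Matrix.one_apply, ← h3, h4]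
    ring
  · rw [Matrix.one_apply_ne (fun h' => h fun s _ => congrFun h' s)]
    simp

theorem addStrand_matU (I : k) (A : kˣ) {i : ℕ} (h : i + 1 < n) :
    addStrand (matU I A n i) = matU I A (n + 1) i := by
  ext a c
  have h' : i + 1 < n + 1 := by omega
  simp only [addStrand, matU, dif_pos h, dif_pos h', onStrands]
  have : (∀ s : Fin (n + 1), s ≠ ⟨i, by omega⟩ → s ≠ ⟨i + 1, h'⟩ → a s = c s) ↔
      (∀ s : Fin n, s ≠ ⟨i, by omega⟩ → s ≠ ⟨i + 1, h⟩ → Fin.init a s = Fin.init c s) ∧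
        a (Fin.last n) = c (Fin.last n) := by
    rw [Fin.forall_fin_succ']
    simp [Fin.ext_iff, Fin.init]
    intro _
    constructor
    · exact fun H => H (by omega) (by omega)
    · exact fun H _ _ => H
  rw [if_congr (this.trans and_comm) rfl rfl, mul_ite, mul_one, mul_zero, ← ite_and]
  rfl

/-- On `n + 2` strands only the generator with index `n` touches the last strand, so words in the
earlier ones come from `n + 1` strands. This feeds the recursion on the number of strands. -/
theorem exists_addStrand_eq (I : k) (A : kˣ)
    {X : Matrix (Fin (n + 2) → Fin 2) (Fin (n + 2) → Fin 2) k}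
    (hX : X ∈ Submonoid.closure (matU I A (n + 2) '' Set.Iio n)) :
    ∃ Y ∈ Submonoid.closure (matU I A (n + 1) '' Set.Iio n), addStrand Y = X := by
  have : matU I A (n + 2) '' Set.Iio n = addStrandHom '' (matU I A (n + 1) '' Set.Iio n) := by
    rw [Set.image_image]
    exact Set.image_congr fun i hi => (addStrand_matU I A (Nat.succ_lt_succ hi)).symm
  rw [this, ← MonoidHom.map_mclosure] at hX
  exact hX

/-- The weighted trace of a product of generators is a power of the loop value. -/
theorem exists_trace_eq_pow {I : k} (hI : I ^ 2 = -1) (A : kˣ) (n : ℕ)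
    {X : Matrix (Fin n → Fin 2) (Fin n → Fin 2) k}
    (hX : X ∈ Submonoid.closure (matU I A n '' Set.Iio (n - 1))) :
    ∃ e : ℕ, Matrix.trace (tensorPow n (eta I A) * X) = loopValue A ^ e := by
  have h0 {n : ℕ} (Y : Matrix (Fin n → Fin 2) (Fin n → Fin 2) k) :
      Matrix.trace (tensorPow (n + 1) (eta I A) * addStrand Y) =
        loopValue A * Matrix.trace (tensorPow n (eta I A) * Y) := by
    have := partialTrace_sandwich (eta I A) Y 1 1
    rw [show addStrand (1 : Matrix (Fin n → Fin 2) (Fin n → Fin 2) k) = 1 from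
      addStrandHom.map_one, mul_one, mul_one, mul_one, partialTrace_one, trace_eta hI] at this
    rw [trace_tensorPow_succ, this]
    simp
  match n with
  | 0 =>
    have : X = 1 := by simpa [Submonoid.mem_bot] using hX
    exact ⟨0, by simp [this, Matrix.trace, tensorPow]⟩
  | 1 =>
    have : X = addStrand 1 := by
      rw [show addStrand (1 : Matrix (Fin 0 → Fin 2) (Fin 0 → Fin 2) k) = 1 from
        addStrandHom.map_one]
      simpa [Submonoid.mem_bot] using hX
    exact ⟨1, by rw [this, h0]; simp [Matrix.trace, tensorPow]⟩
  | n + 2 =>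
    obtain ⟨e, h⟩ := exists_normalForm (U := matU I A (n + 2))
      -- The normal form lives in a monoid, so δ enters as a central scalar matrix. The bound `b`
      -- keeps the relations to the genuine generators, since `matU` has the default value 1 beyond
      -- them.
      (d := algebraMap k _ (loopValue A)) (Algebra.commutes _) (b := n + 1) (m := n)
      (fun i hi => by
        rw [matU, dif_pos (by omega), ← Algebra.smul_def]
        exact cupCap_sq hI A (by simp))
      (fun i hi => by
        rw [matU, matU, dif_pos (by omega), dif_pos (by omega)]
        refine cupCap_adj_right hI A ?_ ?_ ?_ <;> simp; omega)
      (fun i j h hj => by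
        rw [matU, matU, dif_pos (by omega), dif_pos (by omega)]
        refine cupCap_comm I A ?_ ?_ ?_ ?_ ?_ ?_ <;> simp <;> omega)
      n.lt_succ_self hX
    have hd (Z : Matrix (Fin (n + 2) → Fin 2) (Fin (n + 2) → Fin 2) k) :
        Matrix.trace (tensorPow (n + 2) (eta I A) * (algebraMap k _ (loopValue A) ^ e * Z)) =
          loopValue A ^ e * Matrix.trace (tensorPow (n + 2) (eta I A) * Z) := by
      rw [← map_pow, ← Algebra.smul_def, mul_smul_comm, Matrix.trace_smul, smul_eq_mul]
    obtain ⟨y, hy, rfl⟩ | ⟨y, hy, z, hz, rfl⟩ := h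
    · obtain ⟨Y, hY, rfl⟩ := exists_addStrand_eq I A hy
      obtain ⟨e', he'⟩ := exists_trace_eq_pow hI A (n + 1) hY
      exact ⟨e + (1 + e'), by rw [hd, h0, he', pow_add, pow_add, pow_one]⟩
    · obtain ⟨Y, hY, rfl⟩ := exists_addStrand_eq I A hy
      obtain ⟨Z, hZ, rfl⟩ := exists_addStrand_eq I A hz
      -- Tracing out the last strand erases the middle generator and leaves the word `Y * Z` on one
      -- strand fewer.
      obtain ⟨e', he'⟩ := exists_trace_eq_pow hI A (n + 1) (mul_mem hY hZ)
      exact ⟨e + e', by rw [hd, trace_tensorPow_succ, partialTrace_sandwich,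
        partialTrace_matU hI, mul_one, he', pow_add]⟩

end Markov

/-! ### Sums over the indices of a closure -/

section Path
variable {k : Type*} [CommRing k] {n m : ℕ}

/-- The transfer matrix principle: summing over the intermediate levels is matrix multiplication.
The arbitrary end weight `H` lets the induction absorb the first factor into it. -/
theorem sum_path {α : Type*} [Fintype α] [DecidableEq α] (Y : Fin m → Matrix α α k)
    (H : α → α → k) :
    ∑ g : Fin (m + 1) → α, H (g 0) (g (Fin.last m)) * ∏ j, Y j (g j.castSucc) (g j.succ) =
      ∑ a, ∑ c, H a c * (List.ofFn Y).prod a c := by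
  induction m generalizing H with
  | zero =>
    rw [← (Equiv.funUnique (Fin 1) α).symm.sum_comp]
    simp [Matrix.one_apply, Equiv.funUnique]
  | succ m ih =>
    rw [← (Fin.consEquiv fun _ => α).sum_comp, Fintype.sum_prod_type]
    refine Finset.sum_congr rfl fun a _ => ?_
    simp only [Fin.consEquiv_apply, Fin.prod_univ_succ, Fin.castSucc_zero, Fin.cons_zero,
      Fin.cons_succ, ← Fin.succ_last, ← Fin.succ_castSucc, List.ofFn_succ, List.prod_cons]
    have := ih (fun j => Y j.succ) (fun b c => H a c * Y 0 a b)
    simp only [mul_assoc] at this ⊢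
    rw [this, Finset.sum_comm]
    simp only [Matrix.mul_apply, Finset.mul_sum]

theorem trace_mul_prod_ofFn {α : Type*} [Fintype α] [DecidableEq α] (H : Matrix α α k)
    (Y : Fin m → Matrix α α k) :
    Matrix.trace (H * (List.ofFn Y).prod) =
      ∑ g : Fin (m + 1) → α, H (g (Fin.last m)) (g 0) * ∏ j, Y j (g j.castSucc) (g j.succ) := by
  rw [sum_path Y (fun a c => H c a), Finset.sum_comm]
  rfl

/-- This is the expansion into states. The matrices need not commute, so the product of sums is
distributed at the level of entries, along each path of indices. -/
theorem trace_mul_prod_ofFn_sum {α ι : Type*} [Fintype α] [DecidableEq α] [Fintype ι]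
    [DecidableEq ι] (H : Matrix α α k) (r : ι → k) (Z : Fin m → ι → Matrix α α k) :
    Matrix.trace (H * (List.ofFn fun j => ∑ s, r s • Z j s).prod) =
      ∑ S : Fin m → ι, (∏ j, r (S j)) *
        Matrix.trace (H * (List.ofFn fun j => Z j (S j)).prod) := by
  simp only [trace_mul_prod_ofFn, Finset.mul_sum, Matrix.sum_apply, Matrix.smul_apply,
    Finset.prod_univ_sum, Fintype.piFinset_univ, smul_eq_mul, Finset.prod_mul_distrib]
  rw [Finset.sum_comm]
  refine Finset.sum_congr rfl fun S _ => Finset.sum_congr rfl fun g _ => ?_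
  ring

/-- For each strand position, summing over the index of the returning strand contracts a maximum
with a minimum and gives an entry of M Mᵗ. What remains is a sum over paths of levels. -/
theorem sum_closure (M : Matrix (Fin 2) (Fin 2) k)
    (Y : Fin m → Matrix (Fin n → Fin 2) (Fin n → Fin 2) k) :
    ∑ f : (Fin (m + 1) × Fin n) ⊕ Fin n → Fin 2,
      (∏ s, M (f (.inl (0, s))) (f (.inr s))) *
      (∏ s, M (f (.inl (Fin.last m, s))) (f (.inr s))) *
      ∏ j, Y j (fun s => f (.inl (j.castSucc, s))) (fun s => f (.inl (j.succ, s))) =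
    Matrix.trace (tensorPow n (M * M.transpose) * (List.ofFn Y).prod) := by
  rw [trace_mul_prod_ofFn, ← (Equiv.sumArrowEquivProdArrow _ _ _).symm.sum_comp,
    Fintype.sum_prod_type, ← (Equiv.curry _ _ _).symm.sum_comp]
  refine Finset.sum_congr rfl fun g _ => ?_
  simp only [Equiv.sumArrowEquivProdArrow_symm_apply_inl,
    Equiv.sumArrowEquivProdArrow_symm_apply_inr, Equiv.curry_symm_apply, Function.uncurry_apply_pair,
    ← Finset.prod_mul_distrib, ← Finset.sum_mul]
  congr 1
  simp only [tensorPow, Matrix.mul_apply, Finset.prod_univ_sum, Fintype.piFinset_univ,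
    Matrix.transpose_apply]
  refine Finset.sum_congr rfl fun h _ => Finset.prod_congr rfl fun s _ => mul_comm _ _

end Path

/-! ### Products of smoothed crossings -/

section Smoothed
variable {k : Type*} [CommRing k] {n m : ℕ}

/-- The product of the operators of the smoothed letters `i 0, i 1, …`: the letter `i j` is
replaced by `U_{i j}` if `c j = true` and by the identity otherwise. -/
def smoothed (I : k) (A : kˣ) (i : Fin m → Fin (n - 1)) (c : Fin m → Bool) :
    Matrix (Fin n → Fin 2) (Fin n → Fin 2) k :=
  (List.ofFn fun j => if c j then onStrands (cupCap I A) (left (i j)) (right (i j)) else 1).prod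

theorem smoothed_mem_closure (I : k) (A : kˣ) (i : Fin m → Fin (n - 1)) (c : Fin m → Bool) :
    smoothed I A i c ∈ Submonoid.closure (matU I A n '' Set.Iio (n - 1)) := by
  refine Submonoid.list_prod_mem _ fun X hX => ?_
  obtain ⟨j, rfl⟩ := (List.mem_ofFn' _ _).1 hX
  dsimp only
  split_ifs
  · refine Submonoid.subset_closure ⟨i j, (i j).2, ?_⟩
    rw [matU, dif_pos (by omega)]
    rfl
  · exact one_mem _

theorem map_smoothed {k' : Type*} [CommRing k'] (φ : k →+* k') (I : k) (A : kˣ)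
    (i : Fin m → Fin (n - 1)) (c : Fin m → Bool) :
    φ.mapMatrix (smoothed I A i c) = smoothed (φ I) (Units.map φ A) i c := by
  have hM (x y : Fin 2) : φ (matM I A x y) = matM (φ I) (Units.map φ A) x y := by
    fin_cases x <;> fin_cases y <;> simp [matM]
  rw [smoothed, smoothed, map_list_prod, List.map_ofFn]
  congr 2
  funext j
  simp only [Function.comp_apply]
  split_ifs
  · ext a c
    simp only [RingHom.mapMatrix_apply, Matrix.map_apply, onStrands, cupCap, ← hM]
    split_ifs <;> simp
  · exact map_one _

theorem map_trace_smoothed {k' : Type*} [CommRing k'] (φ : k →+* k') (I : k) (A : kˣ)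
    (i : Fin m → Fin (n - 1)) (c : Fin m → Bool) :
    φ (Matrix.trace (tensorPow n (eta I A) * smoothed I A i c)) =
      Matrix.trace (tensorPow n (eta (φ I) (Units.map φ A)) *
        smoothed (φ I) (Units.map φ A) i c) := by
  have hM (x y : Fin 2) : φ (matM I A x y) = matM (φ I) (Units.map φ A) x y := by
    fin_cases x <;> fin_cases y <;> simp [matM]
  have hE : φ.mapMatrix (tensorPow n (eta I A)) =
      tensorPow n (eta (φ I) (Units.map φ A)) := by
    ext a c
    simp [tensorPow, eta, Matrix.mul_apply, hM]
  rw [← map_smoothed, ← hE, ← map_mul]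
  exact map_sum φ _ _

/-- The weighted trace of a product of smoothed crossings is a power of the loop value, with the
same exponent over any two rings. -/
theorem exists_trace_smoothed_eq_pow {k' : Type*} [CommRing k'] {I : k} (hI : I ^ 2 = -1) (A : kˣ)
    {I' : k'} (hI' : I' ^ 2 = -1) (A' : k'ˣ) (i : Fin m → Fin (n - 1)) (c : Fin m → Bool) :
    ∃ e : ℕ, Matrix.trace (tensorPow n (eta I A) * smoothed I A i c) = loopValue A ^ e ∧
      Matrix.trace (tensorPow n (eta I' A') * smoothed I' A' i c) = loopValue A' ^ e := by
  -- One exponent is found over `k × k'`; the two projections carry it to both rings.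
  have hII : ((I, I') : k × k') ^ 2 = -1 := Prod.ext hI hI'
  obtain ⟨e, he⟩ := exists_trace_eq_pow hII (MulEquiv.prodUnits.symm (A, A')) n
    (smoothed_mem_closure _ _ i c)
  have h1 := congrArg (RingHom.fst k k') he
  have h2 := congrArg (RingHom.snd k k') he
  rw [map_trace_smoothed, map_pow] at h1 h2
  have e1 : Units.map (RingHom.fst k k' : k × k' →* k) (MulEquiv.prodUnits.symm (A, A')) = A := by
    ext; rfl
  have e2 : Units.map (RingHom.snd k k' : k × k' →* k') (MulEquiv.prodUnits.symm (A, A')) = A' := by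
    ext; rfl
  rw [e1] at h1
  rw [e2] at h2
  exact ⟨e, h1, h2⟩

end Smoothed

/-! ### Counting loops -/

section Loops
variable {n m : ℕ}

open Classical in
-- Two-colourings of the edges that agree at every joining point are exactly the two-colourings of
-- the set of loops.
theorem two_pow_loops (D : MorseDiagram) (S : D.State) :
    (2 : ℂ) ^ D.loops S =
      ∑ f : D.Edge → Fin 2, if ∀ a b, D.Joined S a b → f a = f b then 1 else 0 := by
  have e : (Quot (D.Joined S) → Fin 2) ≃
      {f : D.Edge → Fin 2 // ∀ a b, D.Joined S a b → f a = f b} :=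
    { toFun := fun g => ⟨fun a => g (Quot.mk _ a), fun a b h => congrArg g (Quot.sound h)⟩
      invFun := fun f => Quot.lift f.1 f.2
      left_inv := fun g => funext fun q => Quot.inductionOn q fun _ => rfl
      right_inv := fun f => rfl }
  have : Finite (Quot (D.Joined S)) := Quot.finite _
  have := Fintype.ofFinite (Quot (D.Joined S))
  have h := Fintype.card_congr e
  rw [Fintype.card_fun, Fintype.card_fin, Fintype.card_subtype] at h
  rw [Finset.sum_boole, ← h, MorseDiagram.loops, Nat.card_eq_fintype_card]
  simp

/-- The unit `i` of the complex numbers; the loop value is `2` there. -/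
noncomputable def unitI : ℂˣ := Units.mk0 Complex.I Complex.I_ne_zero

theorem loopValue_unitI : loopValue unitI = 2 := by
  simp [loopValue, unitI]
  norm_num

theorem matM_unitI (x y : Fin 2) : matM Complex.I unitI x y = if x = y then 0 else -1 := by
  fin_cases x <;> fin_cases y <;> simp [matM, unitI]

theorem eta_unitI : eta Complex.I unitI = 1 := by
  ext x y
  fin_cases x <;> fin_cases y <;>
    simp [eta, Matrix.mul_apply, Fin.sum_univ_two, matM_unitI]

theorem tensorPow_one {k : Type*} [CommRing k] :
    tensorPow n (1 : Matrix (Fin 2) (Fin 2) k) = 1 := by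
  ext a c
  simp only [tensorPow, Matrix.one_apply, Finset.prod_boole, Finset.mem_univ, true_imp_iff,
    funext_iff]

/-- The relation between the indices above and below a smoothed letter. -/
def Compatible (i : Fin (n - 1)) (b : Bool) (a c : Fin n → Fin 2) : Prop :=
  (∀ s, s ≠ left i → s ≠ right i → a s = c s) ∧
    if b then a (left i) = a (right i) ∧ c (left i) = c (right i)
    else a (left i) = c (left i) ∧ a (right i) = c (right i)

/-- Shift the index of the strand `s` by the parity of `s`. -/
def parityShift (n : ℕ) : (Fin n → Fin 2) ≃ (Fin n → Fin 2) :=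
  Equiv.addRight fun s => Fin.ofNat 2 s

open Classical in
theorem submatrix_smoothed_letter (i : Fin (n - 1)) (b : Bool) :
    Matrix.submatrix (if b then onStrands (cupCap Complex.I unitI) (left i) (right i) else 1)
      (parityShift n) (parityShift n) = fun a c => if Compatible i b a c then 1 else 0 := by
  -- Neighbouring strands have opposite parity, so the shift exchanges equality and inequality of
  -- their indices.
  have h : ∀ x y t : Fin 2, x + t = y + (t + 1) ↔ ¬ x = y := by decide
  have h' : Fin.ofNat 2 (right i : ℕ) = Fin.ofNat 2 (left i : ℕ) + 1 := by
    ext; simp [left, right, Fin.val_add]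
  ext a c
  cases b
  · simp only [Bool.false_eq_true, if_false, Matrix.submatrix_one_equiv, Matrix.one_apply,
      Compatible]
    congr 1
    refine propext ⟨fun h => by simp [h], fun h => funext fun s => ?_⟩
    by_cases h1 : s = left i
    · rw [h1]; exact h.2.1
    · by_cases h2 : s = right i
      · rw [h2]; exact h.2.2
      · exact h.1 s h1 h2
  · simp only [if_true, Matrix.submatrix_apply, onStrands, cupCap, Compatible, parityShift,
      Equiv.coe_addRight, Pi.add_apply, add_left_inj, matM_unitI, h', h]
    split_ifs <;> simp_all

open Classical in
-- At A = i the weight is the identity, and the parity shift is a permutation of the basis.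
-- Conjugating by it leaves the trace unchanged and turns every letter into the indicator of
-- compatibility; `sum_closure` with `M = 1` then counts the compatible assignments.
theorem sum_compatible (i : Fin m → Fin (n - 1)) (c : Fin m → Bool) :
    (∑ f : (Fin (m + 1) × Fin n) ⊕ Fin n → Fin 2,
      if (∀ s, f (.inl (0, s)) = f (.inr s)) ∧ (∀ s, f (.inl (Fin.last m, s)) = f (.inr s)) ∧
        ∀ j, Compatible (i j) (c j) (fun s => f (.inl (j.castSucc, s)))
          (fun s => f (.inl (j.succ, s))) then (1 : ℂ) else 0) =
    Matrix.trace (tensorPow n (eta Complex.I unitI) * smoothed Complex.I unitI i c) := by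
  have h := sum_closure (1 : Matrix (Fin 2) (Fin 2) ℂ) (fun j => Matrix.submatrix
    (if c j then onStrands (cupCap Complex.I unitI) (left (i j)) (right (i j)) else 1)
      (parityShift n) (parityShift n))
  have hs : (List.ofFn fun j => Matrix.submatrix
      (if c j then onStrands (cupCap Complex.I unitI) (left (i j)) (right (i j)) else 1)
        (parityShift n) (parityShift n)).prod =
      (smoothed Complex.I unitI i c).submatrix (parityShift n) (parityShift n) := by
    have := map_list_prod (Matrix.reindexAlgEquiv ℂ ℂ (parityShift n).symm)
      (List.ofFn fun j =>
        if c j then onStrands (cupCap Complex.I unitI) (left (i j)) (right (i j)) else 1)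
    rw [List.map_ofFn] at this
    exact this.symm
  have ht : ((smoothed Complex.I unitI i c).submatrix (parityShift n) (parityShift n)).trace =
      (smoothed Complex.I unitI i c).trace :=
    (parityShift n).sum_comp fun a => smoothed Complex.I unitI i c a a
  rw [hs, Matrix.transpose_one, mul_one, tensorPow_one, one_mul, ht] at h
  rw [eta_unitI, tensorPow_one, one_mul, ← h]
  refine Finset.sum_congr rfl fun f _ => ?_
  simp only [submatrix_smoothed_letter, Matrix.one_apply, Finset.prod_boole, Finset.mem_univ,
    true_imp_iff, ite_and, mul_ite, mul_one, mul_zero]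
  split_ifs <;> rfl

theorem two_pow_loops_closure (w : BraidWord n) (S : w.closure.State) :
    (2 : ℂ) ^ w.closure.loops S =
      Matrix.trace (tensorPow n (eta Complex.I unitI) *
        smoothed Complex.I unitI (fun j => (w.get j).1) (fun j => S j == (w.get j).2)) := by
  classical
  rw [two_pow_loops, ← sum_compatible]
  refine Finset.sum_congr rfl fun f _ => ?_
  congr 1
  refine propext ⟨fun h => ⟨fun s => h _ _ (.maximum (D := w.closure) s),
    fun s => h _ _ (.minimum (D := w.closure) s),
    fun j => ⟨fun s h1 h2 => h _ _ (.joint (D := w.closure) ⟨(j, s), h1, h2⟩), ?_⟩⟩, fun h a b hab => ?_⟩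
  · split_ifs with hj
    · rw [beq_iff_eq] at hj
      exact ⟨h _ _ (.cup (D := w.closure) j hj), h _ _ (.cap (D := w.closure) j hj)⟩
    · rw [beq_iff_eq] at hj
      exact ⟨h _ _ (.west (D := w.closure) j hj), h _ _ (.east (D := w.closure) j hj)⟩
  · obtain ⟨h1, h2, h3⟩ := h
    cases hab with
    | maximum s => exact h1 s
    | minimum s => exact h2 s
    | joint p => exact (h3 p.1.1).1 p.1.2 p.2.1 p.2.2
    | cup j hj => exact ((if_pos (beq_iff_eq.2 hj)).mp (h3 j).2).1
    | cap j hj => exact ((if_pos (beq_iff_eq.2 hj)).mp (h3 j).2).2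
    | west j hj => exact ((if_neg (mt beq_iff_eq.1 hj)).mp (h3 j).2).1
    | east j hj => exact ((if_neg (mt beq_iff_eq.1 hj)).mp (h3 j).2).2

theorem two_pow_closureLoops (w : List (Fin (n - 1))) :
    (2 : ℂ) ^ closureLoops w =
      Matrix.trace (tensorPow n (eta Complex.I unitI) *
        smoothed Complex.I unitI w.get fun _ => true) := by
  classical
  refine (two_pow_loops _ _).trans ?_
  rw [← sum_compatible]
  refine Finset.sum_congr rfl fun f _ => ?_
  congr 1
  refine propext ⟨fun h => ⟨fun s => h _ _ (.maximum (D := tlClosure w) (.inl s)),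
    fun s => h _ _ (.minimum (D := tlClosure w) (.inl s)),
    fun j => ⟨fun s h1 h2 => h _ _ (.joint (D := tlClosure w) ⟨(j, s), h1, h2⟩), ?_⟩⟩, fun h a b hab => ?_⟩
  · rw [if_pos rfl]
    exact ⟨h _ _ (.minimum (D := tlClosure w) (.inr j)),
      h _ _ (.maximum (D := tlClosure w) (.inr j))⟩
  · obtain ⟨h1, h2, h3⟩ := h
    cases hab with
    | maximum s =>
      rcases s with s | j
      · exact h1 s
      · exact (h3 j).2.2
    | minimum s =>
      rcases s with s | j
      · exact h2 s
      · exact (h3 j).2.1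
    | joint p => exact (h3 p.1.1).1 p.1.2 p.2.1 p.2.2
    | cup j => exact j.elim
    | cap j => exact j.elim
    | west j => exact j.elim
    | east j => exact j.elim

/-- The exponent is read off over ℂ, where the loop value is 2 and distinct powers differ, and then
transferred to `k`. -/
theorem trace_smoothed_eq_pow {k : Type*} [CommRing k] {I : k} (hI : I ^ 2 = -1) (A : kˣ)
    (i : Fin m → Fin (n - 1)) (c : Fin m → Bool) {l : ℕ}
    (hl : (2 : ℂ) ^ l = Matrix.trace (tensorPow n (eta Complex.I unitI) *
      smoothed Complex.I unitI i c)) :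
    Matrix.trace (tensorPow n (eta I A) * smoothed I A i c) = loopValue A ^ l := by
  obtain ⟨e, h1, h2⟩ := exists_trace_smoothed_eq_pow hI A Complex.I_sq unitI i c
  rw [← hl, loopValue_unitI] at h2
  rw [h1, Nat.pow_right_injective le_rfl (show 2 ^ l = 2 ^ e by exact_mod_cast h2)]

end Loops

/-! ### The amplitude and the bracket of the closure of a braid word -/

section Closure
variable {k : Type*} [CommRing k] {n : ℕ}

/-- The operator of a letter of a braid word. -/
def letterMatrix (I : k) (A : kˣ) (p : Fin (n - 1) × Bool) :
    Matrix (Fin n → Fin 2) (Fin n → Fin 2) k :=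
  onStrands (if p.2 then matR I A else matRInv I A) (left p.1) (right p.1)

theorem onStrands_smul_add_smul_one (a b : k) (X : Matrix (Fin 2 × Fin 2) (Fin 2 × Fin 2) k)
    (l r : Fin n) :
    onStrands (a • X + b • 1) l r = a • onStrands X l r + b • 1 := by
  rw [← onStrands_one (l := l) (r := r)]
  ext x y
  simp only [onStrands, Matrix.add_apply, Matrix.smul_apply]
  split_ifs <;> simp

/-- Both signs fit one formula: the smoothing is horizontal when its type matches the sign of the
crossing, while the weight depends on the type alone. -/
theorem letterMatrix_eq_sum (I : k) (A : kˣ) (p : Fin (n - 1) × Bool) :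
    letterMatrix I A p = ∑ s : Bool, (if s then (A : k) else ((A⁻¹ : kˣ) : k)) •
      if s == p.2 then onStrands (cupCap I A) (left p.1) (right p.1) else 1 := by
  obtain ⟨i, _ | _⟩ := p
  · simp [letterMatrix, matRInv, onStrands_smul_add_smul_one, add_comm]
  · simp [letterMatrix, matR, onStrands_smul_add_smul_one]

theorem tlMatrix_rho_toBraid {I : k} (hI : I ^ 2 = -1) (A : kˣ) (w : BraidWord n) :
    tlMatrix hI A n (rho A n w.toBraid) = (w.map (letterMatrix I A)).prod := by
  induction w with
  | nil =>
    have : BraidWord.toBraid ([] : BraidWord n) = 1 := map_one (PresentedGroup.mk _)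
    simp [this]
  | cons p w ih =>
    have h : BraidWord.toBraid (p :: w) = BraidWord.toBraid [p] * BraidWord.toBraid w :=
      map_mul (PresentedGroup.mk _) (FreeGroup.mk [p]) (FreeGroup.mk w)
    have hp : tlMatrix hI A n (rho A n (BraidWord.toBraid [p])) = letterMatrix I A p := by
      obtain ⟨i, _ | _⟩ := p
      · have : BraidWord.toBraid [(i, false)] = (sigma i)⁻¹ :=
          map_inv (PresentedGroup.mk _) (FreeGroup.of i)
        rw [this, rho_sigma_inv, map_add, map_smul, map_smul, tlMatrix_genU, map_one]
        exact (onStrands_smul_add_smul_one _ _ _ _ _).symm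
      · exact tlMatrix_rho_sigma hI A i
    rw [h, map_mul, map_mul, ih, hp, List.map_cons, List.prod_cons]

theorem map_eq_ofFn_get {α β : Type*} (g : α → β) (w : List α) :
    w.map g = List.ofFn fun j => g (w.get j) := by
  conv_lhs => rw [← List.ofFn_get w, List.map_ofFn]
  rfl

theorem tlMatrix_connectionElement {I : k} (hI : I ^ 2 = -1) (A : kˣ) (w : List (Fin (n - 1))) :
    tlMatrix hI A n (connectionElement (loopValue A) w) =
      smoothed I A w.get fun _ => true := by
  rw [connectionElement, map_list_prod, List.map_map, map_eq_ofFn_get, smoothed]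
  simp [tlMatrix_genU]

theorem amplitude_closure (I : k) (A : kˣ) (w : BraidWord n) :
    w.closure.amplitude I A =
      Matrix.trace (tensorPow n (eta I A) * (w.map (letterMatrix I A)).prod) := by
  rw [map_eq_ofFn_get, eta, ← sum_closure]
  refine Finset.sum_congr rfl fun f _ => ?_
  rw [mul_assoc]
  congr 1
  have hj (j : Fin w.length) : letterMatrix I A (w.get j)
      (fun s => f (.inl (j.castSucc, s))) (fun s => f (.inl (j.succ, s))) =
      (if (w.get j).2 then matR I A else matRInv I A)
        (f (.inl (j.castSucc, left (w.get j).1)), f (.inl (j.castSucc, right (w.get j).1)))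
        (f (.inl (j.succ, left (w.get j).1)), f (.inl (j.succ, right (w.get j).1))) *
      if ∀ s, s ≠ left (w.get j).1 → s ≠ right (w.get j).1 →
        f (.inl (j.castSucc, s)) = f (.inl (j.succ, s)) then 1 else 0 := by
    simp [letterMatrix, onStrands]
  simp only [hj]
  rw [Finset.prod_mul_distrib]
  congr 1
  rw [Finset.prod_boole, Finset.prod_boole]
  congr 1
  refine propext ⟨fun h j _ s h1 h2 => h ⟨(j, s), h1, h2⟩ (Finset.mem_univ _),
    fun h p _ => h p.1.1 (Finset.mem_univ _) p.1.2 p.2.1 p.2.2⟩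

/-- The exponent `loops - 1` in the bracket is truncated; positivity makes multiplication by δ
restore `loops`. -/
theorem loops_closure_pos (hn : 1 ≤ n) (w : BraidWord n) (S : w.closure.State) :
    0 < w.closure.loops S := by
  have : Finite (Quot (w.closure.Joined S)) := Quot.finite _
  have : Nonempty (Quot (w.closure.Joined S)) := ⟨Quot.mk _ (Sum.inr ⟨0, hn⟩)⟩
  exact Nat.card_pos

theorem loopValue_mul_bracket_closure {I : k} (hI : I ^ 2 = -1) (A : kˣ) (hn : 1 ≤ n)
    (w : BraidWord n) :
    loopValue A * w.closure.bracket A =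
      Matrix.trace (tensorPow n (eta I A) * (w.map (letterMatrix I A)).prod) := by
  simp only [map_eq_ofFn_get, letterMatrix_eq_sum]
  rw [trace_mul_prod_ofFn_sum, MorseDiagram.bracket, Finset.mul_sum]
  refine Finset.sum_congr rfl fun S _ => ?_
  rw [mul_left_comm, ← pow_succ', Nat.sub_add_cancel (loops_closure_pos hn w S),
    ← trace_smoothed_eq_pow hI A _ _ (two_pow_loops_closure w S)]
  rfl

end Closure

end BraidTrace

/-! ### The trace formulas for Temperley–Lieb words and closed braids -/

theorem mainTheorem4 {k : Type*} [CommRing k] {I : k} (hI : I ^ 2 = -1) (A : kˣ)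
    (n : ℕ) (hn : 1 ≤ n) :
    (∀ w : List (Fin (n - 1)),
      Matrix.trace (tensorPow n (eta I A) *
          tlMatrix hI A n (connectionElement (loopValue A) w)) =
        loopValue A ^ closureLoops w) ∧
    (∀ (b : BraidGroup n) (w : BraidWord n), w.toBraid = b →
      w.closure.amplitude I A = loopValue A * w.closure.bracket A ∧
      loopValue A * w.closure.bracket A =
        Matrix.trace (tensorPow n (eta I A) * tlMatrix hI A n (rho A n b))) := by
  refine ⟨fun w => ?_, ?_⟩
  · rw [tlMatrix_connectionElement]
    exact trace_smoothed_eq_pow hI A _ _ (two_pow_closureLoops w)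
  · rintro _ w rfl
    rw [loopValue_mul_bracket_closure hI A hn, amplitude_closure, tlMatrix_rho_toBraid]
    exact ⟨rfl, rfl⟩
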